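/- **Setting.** Let $\mathcal H$ be a finite-dimensional complex Hilbert space, let $W_0,\dots,W_{d-1}\in\mathcal H$ ($d\ge 1$) be orthonormal, $\mathcal C=\mathrm{span}\{W_\mu\}$, $\Pi_{\mathcal C}=\sum_\mu |W_\mu\rangle\langle W_\mu|$, and let $H_{\rm sys}$ be a self-adjoint operator and $F_1,\dots,F_N$ linear operators on $\mathcal H$. Put $F_0=1$ and assume the Knill–Laflamme condition: there are constants $c_{l'l}\in\mathbb C$ with $\Pi_{\mathcal C}F_{l'}^\dagger F_l\Pi_{\mathcal C}=c_{l'l}\Pi_{\mathcal C}$ for all $l,l'\in\{0,\dots,N\}$. Write $\|\cdot\|$ for the operator norm, $\gamma=\sum_{k=1}^N\|F_k\|^2$, and $D(A)\rho=A\rho A^\dagger-\tfrac12(A^\dagger A\rho+\rho A^\dagger A)$. **Engineered jump operators.** Let $\mathcal S_\mu=\mathrm{span}(\{W_\mu\}\cup\{F_kW_\mu:1\le k\le N\})$, of common dimension $m$, and let $\mathcal S_{\rm ccs}=\mathrm{span}\bigcup_\mu\mathcal S_\mu$. A *design* consists of vectors $|W_\mu;i\rangle$ ($1\le i\le m-1$)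 such that, for every $\mu$, the vectors $|W_\mu\rangle,|W_\mu;1\rangle,\dots,|W_\mu;m-1\rangle$ form an orthonormal basis of $\mathcal S_\mu$, and such that $\langle W_\mu;i|F_k|W_\mu\rangle$ does not depend on $\mu$; of an orthonormal basis $(\phi_p)_p$ of $\mathcal S_{\rm ccs}^\perp$; and of arbitrary unit vectors $\Phi_p\in\mathcal S_{\rm ccs}$. Its jump operators $F_{{\rm eng},j}$ are the corrective jumps $\sum_{\mu}|W_\mu\rangle\langle W_\mu;i|$ ($1\le i\le m-1$) and the preventive jumps $|\Phi_p\rangle\langle\phi_p|$ (all $p$). For a design and $M>0$, with $H_{\rm eng}=-H_{\rm sys}$, let $$\mathcal L\rho=-i[H_{\rm eng}+H_{\rm sys},\rho]+M\sum_jD(F_{{\rm eng},j})\rho+\sum_{k=1}^ND(F_k)\rho .$$ **Theorem (AutoQEC condition).** There is an absolute constant $C>0$ such that in every setting as above a design exists, and for every design, every $M>0$ and every density operator $\rho_{\mathcal C}$ supported on $\mathcal C$, $$\|e^{T\mathcal L}\rho_{\mathcal C}-\rho_{\mathcal C}\|\le C\,\frac{\gamma}{M}\,(1+\gamma T)\qquad\text{for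 all }T\ge 0 .$$ In particular the error is $O(\gamma T/M)$ on times bounded away from $0$: for all $T\ge T_0>0$, $$\|e^{T\mathcal L}\rho_{\mathcal C}-\rho_{\mathcal C}\|\le C\Big(\frac1{T_0}+\gamma\Big)\frac{\gamma T}{M}.$$ -/

import Mathlib

open scoped InnerProductSpace

universe u

noncomputable section

namespace AutoQEC

variable {H : Type u} [NormedAddCommGroup H] [InnerProductSpace ℂ H]

/-- The rank-one operator `|a⟩⟨b|`. -/
def ketBra (a b : H) : H →L[ℂ] H :=
  (innerSL ℂ b).smulRight a

theorem ketBra_apply (a b x : H) : ketBra a b x = ⟪b, x⟫_ℂ • a := by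
  simp [ketBra]

/-- The code space: the span of the code words `W μ`. -/
def codeSpace {d : ℕ} (W : Fin d → H) : Submodule ℂ H :=
  Submodule.span ℂ (Set.range W)

/-- `Π_C = ∑ μ, |W μ⟩⟨W μ|`. -/
def codeProj {d : ℕ} (W : Fin d → H) : H →L[ℂ] H :=
  ∑ μ, ketBra (W μ) (W μ)

/-- The error set `E 0 = 1`, `E k = F k` for `k = 1, …, N`. -/
def errorSet {N : ℕ} (F : Fin N → (H →L[ℂ] H)) : Fin (N + 1) → (H →L[ℂ] H) :=
  Fin.cons 1 F

/-- The strength of the intrinsic dissipation, `γ = ∑ k, ‖F k‖ ^ 2`. -/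
def intrinsicStrength {N : ℕ} (F : Fin N → (H →L[ℂ] H)) : ℝ :=
  ∑ k, ‖F k‖ ^ 2

/-- The corrupted sector `S μ = span ({W μ} ∪ {F k (W μ) : k})`. -/
def corruptedSector {d N : ℕ} (W : Fin d → H) (F : Fin N → (H →L[ℂ] H)) (μ : Fin d) :
    Submodule ℂ H :=
  Submodule.span ℂ ({W μ} ∪ Set.range fun k => F k (W μ))

/-- The corrupted code space: the span of all corrupted sectors. -/
def corruptedCodeSpace {d N : ℕ} (W : Fin d → H) (F : Fin N → (H →L[ℂ] H)) :
    Submodule ℂ H :=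
  ⨆ μ, corruptedSector W F μ

/-- The choices that enter the construction of the engineered jump operators for the code words
`W` and the intrinsic jump operators `F`. Here `r = m - 1`, where `m` is the common dimension of
the corrupted sectors, and `q` is the dimension of the complement of the corrupted code space. -/
structure Design {d N : ℕ} (W : Fin d → H) (F : Fin N → (H →L[ℂ] H)) where
  /-- the number of corrective jumps -/
  r : ℕ
  /-- the number of preventive jumps -/
  q : ℕ
  /-- the corrupted code words `|W μ; i⟩` -/
  V : Fin d → Fin r → H
  /-- the residual states `φ p` -/
  φ : Fin q → H
  /-- the states `Φ p` into which the residual states are pumped -/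
  Φ : Fin q → H
  /-- `W μ, V μ 1, …, V μ r` is an orthonormal basis of the corrupted sector `S μ`. -/
  orthonormal_sector : ∀ μ, Orthonormal ℂ (Fin.cons (W μ) (V μ) : Fin (r + 1) → H)
  span_sector : ∀ μ,
    Submodule.span ℂ (Set.range (Fin.cons (W μ) (V μ) : Fin (r + 1) → H)) = corruptedSector W F μ
  /-- `⟨W μ; i| F k |W μ⟩` does not depend on `μ`. -/
  matrixElement_eq : ∀ μ ν i k, ⟪V μ i, F k (W μ)⟫_ℂ = ⟪V ν i, F k (W ν)⟫_ℂ
  /-- The `φ p` are an orthonormal basis of the orthogonal complement of the corrupted code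
  space. -/
  orthonormal_residual : Orthonormal ℂ φ
  span_residual : Submodule.span ℂ (Set.range φ) = (corruptedCodeSpace W F)ᗮ
  /-- The `Φ p` are arbitrary unit vectors of the corrupted code space. -/
  target_mem : ∀ p, Φ p ∈ corruptedCodeSpace W F
  norm_target : ∀ p, ‖Φ p‖ = 1

/-- The engineered jump operators: the corrective jumps `∑ μ, |W μ⟩⟨W μ; i|` and the preventive
jumps `|Φ p⟩⟨φ p|`. -/
def Design.jump {d N : ℕ} {W : Fin d → H} {F : Fin N → (H →L[ℂ] H)} (D : Design W F) :
    Fin D.r ⊕ Fin D.q → (H →L[ℂ] H)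
  | Sum.inl i => ∑ μ, ketBra (W μ) (D.V μ i)
  | Sum.inr p => ketBra (D.Φ p) (D.φ p)

section Dynamics

variable [CompleteSpace H]

/-- The Knill–Laflamme condition for the error set `{1, F 1, …, F N}`. -/
def KnillLaflamme {d N : ℕ} (W : Fin d → H) (F : Fin N → (H →L[ℂ] H)) : Prop :=
  ∃ c : Fin (N + 1) → Fin (N + 1) → ℂ, ∀ l' l,
    codeProj W * ContinuousLinearMap.adjoint (errorSet F l') * errorSet F l * codeProj W
      = c l' l • codeProj W

/-- A density operator supported on the code space. -/
structure IsCodeState {d : ℕ} (W : Fin d → H) (ρ : H →L[ℂ] H) : Prop where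
  isPositive : ρ.IsPositive
  trace_eq_one : LinearMap.trace ℂ H (ρ : H →ₗ[ℂ] H) = 1
  range_le : LinearMap.range (ρ : H →ₗ[ℂ] H) ≤ codeSpace W

/-- The superoperator `ρ ↦ A ρ B`. -/
def sandwich (A B : H →L[ℂ] H) : (H →L[ℂ] H) →L[ℂ] (H →L[ℂ] H) :=
  ContinuousLinearMap.mulLeftRight ℂ (H →L[ℂ] H) A B

theorem sandwich_apply (A B ρ : H →L[ℂ] H) : sandwich A B ρ = A * ρ * B := by
  simp [sandwich]

/-- `D(A) ρ = A ρ A† - (1/2) (A† A ρ + ρ A† A)`. -/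
def dissipator (A : H →L[ℂ] H) : (H →L[ℂ] H) →L[ℂ] (H →L[ℂ] H) :=
  sandwich A (ContinuousLinearMap.adjoint A)
    - (1 / 2 : ℂ) • (sandwich (ContinuousLinearMap.adjoint A * A) 1
        + sandwich 1 (ContinuousLinearMap.adjoint A * A))

theorem dissipator_apply (A ρ : H →L[ℂ] H) :
    dissipator A ρ = A * ρ * ContinuousLinearMap.adjoint A
      - (1 / 2 : ℂ) • (ContinuousLinearMap.adjoint A * A * ρ
          + ρ * (ContinuousLinearMap.adjoint A * A)) := by
  simp only [dissipator, _root_.sub_apply, _root_.smul_apply,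
    _root_.add_apply, sandwich_apply, mul_one, one_mul]

/-- The generator
`L ρ = -i [Heng + Hsys, ρ] + M ∑ i, D(Feng i) ρ + ∑ k, D(F k) ρ`. -/
def lindbladian {ι κ : Type*} [Fintype ι] [Fintype κ] (Heng Hsys : H →L[ℂ] H) (M : ℝ)
    (Feng : ι → (H →L[ℂ] H)) (F : κ → (H →L[ℂ] H)) :
    (H →L[ℂ] H) →L[ℂ] (H →L[ℂ] H) :=
  (-Complex.I) • (sandwich (Heng + Hsys) 1 - sandwich 1 (Heng + Hsys))
    + (M : ℂ) • ∑ i, dissipator (Feng i) + ∑ k, dissipator (F k)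

theorem lindbladian_apply {ι κ : Type*} [Fintype ι] [Fintype κ] (Heng Hsys : H →L[ℂ] H) (M : ℝ)
    (Feng : ι → (H →L[ℂ] H)) (F : κ → (H →L[ℂ] H)) (ρ : H →L[ℂ] H) :
    lindbladian Heng Hsys M Feng F ρ
      = (-Complex.I) • ((Heng + Hsys) * ρ - ρ * (Heng + Hsys))
        + (M : ℂ) • ∑ i, dissipator (Feng i) ρ + ∑ k, dissipator (F k) ρ := by
  simp only [lindbladian, _root_.sub_apply, _root_.smul_apply,
    _root_.add_apply, _root_.sum_apply, sandwich_apply, mul_one, one_mul]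

/-- The error `ε(T; ρ) = ‖e^{TL} ρ - ρ‖` in the operator norm. -/
def evolutionError (L : (H →L[ℂ] H) →L[ℂ] (H →L[ℂ] H)) (T : ℝ) (ρ : H →L[ℂ] H) : ℝ :=
  ‖NormedSpace.exp ((T : ℂ) • L) ρ - ρ‖

end Dynamics

end AutoQEC

end

/-! Since the Hamiltonians cancel, the generator is `M • K + R`, with `K` the engineered and `R` the
intrinsic dissipation. Let `Q` be the projection onto the complement of the code space. The sectors
are mutually orthogonal, so their bases and the residual states form one orthonormal basis of the
whole space. Hence the jumps satisfy `∑ j, J j† J j = Q`, and by the Knill–Laflamme condition each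
`J j * F k` acts on the code space as a scalar.

A code state `ρ` is stationary for `K`, and these two facts make `K X = -R ρ` explicitly solvable
(`dissipator_add_sum_dissipator_corrector`): populations outside the code space decay at rate 1 back
to multiples of `ρ`, code–complement coherences at rate 1/2. With `Z = X / M` the terms of order `M`
and of order 1 in the image of `ρ + Z` cancel, leaving `R Z`. In trace norm `Z` is at most `7γ/M`
and `R Z` at most `14γ²/M`.

The evolution is positive and trace preserving, hence contracts the trace norm of self-adjoint
operators, so the error is at most `2‖Z‖₁ + T‖R Z‖₁` (`evolutionError_le`). The trace norm dominates
the operator norm, so no dimension enters the constant. -/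

namespace AutoQEC

open ContinuousLinearMap Filter Topology

/-! ### Trace-norm estimates for self-adjoint operators. -/

section Trace

variable {H : Type u} [NormedAddCommGroup H] [InnerProductSpace ℂ H]

/-- The trace of continuous linear operators as a linear functional. -/
noncomputable def opTrace : (H →L[ℂ] H) →ₗ[ℂ] ℂ :=
  LinearMap.trace ℂ H ∘ₗ ContinuousLinearMap.coeLM ℂ

theorem opTrace_apply (A : H →L[ℂ] H) : opTrace A = LinearMap.trace ℂ H (A : H →ₗ[ℂ] H) := rfl

theorem opTrace_mul_comm (A B : H →L[ℂ] H) : opTrace (A * B) = opTrace (B * A) :=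
  LinearMap.trace_mul_comm ℂ (A : H →ₗ[ℂ] H) (B : H →ₗ[ℂ] H)

/-- `X` is the difference of two positive operators with total trace at most `t`; equivalently,
`X` is self-adjoint with trace norm at most `t`. -/
def TraceBounded (X : H →L[ℂ] H) (t : ℝ) : Prop :=
  ∃ P Q : H →L[ℂ] H, 0 ≤ P ∧ 0 ≤ Q ∧ X = P - Q ∧ (opTrace P).re + (opTrace Q).re ≤ t

namespace TraceBounded

variable {X Y : H →L[ℂ] H} {s t : ℝ}

theorem of_nonneg (hX : 0 ≤ X) (h : (opTrace X).re ≤ t) : TraceBounded X t :=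
  ⟨X, 0, hX, le_rfl, by simp, by simpa using h⟩

theorem zero (ht : 0 ≤ t) : TraceBounded (0 : H →L[ℂ] H) t :=
  of_nonneg le_rfl (by simpa using ht)

theorem mono (h : TraceBounded X s) (hst : s ≤ t) : TraceBounded X t := by
  obtain ⟨P, Q, hP, hQ, hX, ht⟩ := h
  exact ⟨P, Q, hP, hQ, hX, ht.trans hst⟩

theorem neg (hX : TraceBounded X s) : TraceBounded (-X) s := by
  obtain ⟨P, Q, hP, hQ, rfl, ht⟩ := hX
  exact ⟨Q, P, hQ, hP, by abel, by linarith⟩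

variable [CompleteSpace H]

theorem add (hX : TraceBounded X s) (hY : TraceBounded Y t) : TraceBounded (X + Y) (s + t) := by
  obtain ⟨P, Q, hP, hQ, rfl, ht⟩ := hX
  obtain ⟨P', Q', hP', hQ', rfl, ht'⟩ := hY
  refine ⟨P + P', Q + Q', add_nonneg hP hP', add_nonneg hQ hQ', by abel, ?_⟩
  simp only [map_add, Complex.add_re]
  linarith

theorem sub (hX : TraceBounded X s) (hY : TraceBounded Y t) : TraceBounded (X - Y) (s + t) := by
  rw [sub_eq_add_neg]
  exact hX.add hY.neg

theorem smul {c : ℝ} (hc : 0 ≤ c) (hX : TraceBounded X s) :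
    TraceBounded ((c : ℂ) • X) (c * s) := by
  obtain ⟨P, Q, hP, hQ, rfl, ht⟩ := hX
  refine ⟨c • P, c • Q, smul_nonneg hc hP, smul_nonneg hc hQ, ?_, ?_⟩
  · rw [Complex.coe_smul, smul_sub]
  · rw [← Complex.coe_smul, ← Complex.coe_smul]
    simp only [map_smul, smul_eq_mul, Complex.re_ofReal_mul, ← mul_add]
    gcongr

theorem sum {ι : Type*} {I : Finset ι} {X : ι → H →L[ℂ] H} {t : ι → ℝ}
    (h : ∀ i ∈ I, TraceBounded (X i) (t i)) : TraceBounded (∑ i ∈ I, X i) (∑ i ∈ I, t i) := by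
  classical
  induction I using Finset.induction_on with
  | empty => simpa using zero le_rfl
  | insert i I hi ih =>
    rw [Finset.sum_insert hi, Finset.sum_insert hi]
    exact (h i (by simp)).add (ih fun j hj => h j (by simp [hj]))

end TraceBounded

variable [CompleteSpace H]

theorem re_opTrace_star_mul_self {ι : Type*} [Fintype ι] (b : OrthonormalBasis ι ℂ H)
    (A : H →L[ℂ] H) : (opTrace (star A * A)).re = ∑ i, ‖A (b i)‖ ^ 2 := by
  rw [opTrace_apply, LinearMap.trace_eq_sum_inner _ b, Complex.re_sum]
  refine Finset.sum_congr rfl fun i _ => ?_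
  have h : ⟪b i, (star A * A) (b i)⟫_ℂ = ⟪A (b i), A (b i)⟫_ℂ := by
    rw [star_eq_adjoint, mul_apply_eq_comp, adjoint_inner_right]
  have h2 : ⟪A (b i), A (b i)⟫_ℂ = ((‖A (b i)‖ ^ 2 : ℝ) : ℂ) := by
    simp [inner_self_eq_norm_sq_to_K]
  exact (congrArg Complex.re (h.trans h2)).trans (Complex.ofReal_re _)

variable [FiniteDimensional ℂ H]

/-- Writing `A = B† B`, this compares the squared operator norm of `B` with its squared
Hilbert–Schmidt norm. -/
theorem norm_le_re_opTrace {A : H →L[ℂ] H} (hA : 0 ≤ A) : ‖A‖ ≤ (opTrace A).re := by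
  obtain ⟨B, rfl⟩ := CStarAlgebra.nonneg_iff_eq_star_mul_self.1 hA
  set b := stdOrthonormalBasis ℂ H
  have hB : ‖B‖ ≤ √(∑ i, ‖B (b i)‖ ^ 2) := by
    refine opNorm_le_bound _ (Real.sqrt_nonneg _) fun x => ?_
    have h1 : ‖B x‖ ≤ ∑ i, ‖⟪b i, x⟫_ℂ‖ * ‖B (b i)‖ := by
      conv_lhs => rw [← b.sum_repr' x, map_sum]
      refine (norm_sum_le _ _).trans (Finset.sum_le_sum fun i _ => ?_)
      rw [map_smul, norm_smul]
    refine h1.trans ((Real.sum_mul_le_sqrt_mul_sqrt _ _ _).trans ?_)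
    rw [b.sum_sq_norm_inner_right, Real.sqrt_sq (norm_nonneg _), mul_comm]
  rw [CStarRing.norm_star_mul_self, re_opTrace_star_mul_self b]
  have h0 : (0 : ℝ) ≤ ∑ i, ‖B (b i)‖ ^ 2 := by positivity
  calc ‖B‖ * ‖B‖ ≤ √(∑ i, ‖B (b i)‖ ^ 2) * √(∑ i, ‖B (b i)‖ ^ 2) := by gcongr
    _ = _ := Real.mul_self_sqrt h0

/-- With `P = B† B`, cyclicity turns the two traces into squared Hilbert–Schmidt norms of `A B†` and
`B†`, which are compared basis vector by basis vector. -/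
theorem re_opTrace_conj_le {P : H →L[ℂ] H} (hP : 0 ≤ P) (A : H →L[ℂ] H) :
    (opTrace (A * P * star A)).re ≤ ‖A‖ ^ 2 * (opTrace P).re := by
  obtain ⟨B, rfl⟩ := CStarAlgebra.nonneg_iff_eq_star_mul_self.1 hP
  have h1 : opTrace (A * (star B * B) * star A) = opTrace (star (A * star B) * (A * star B)) := by
    rw [opTrace_mul_comm (star (A * star B)), star_mul, star_star]
    simp only [mul_assoc]
  have h2 : opTrace (star B * B) = opTrace (star (star B) * star B) := by
    rw [star_star, opTrace_mul_comm]
  set b := stdOrthonormalBasis ℂ H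
  rw [h1, h2, re_opTrace_star_mul_self b, re_opTrace_star_mul_self b, Finset.mul_sum]
  refine Finset.sum_le_sum fun i _ => ?_
  rw [← mul_pow]
  gcongr
  exact le_opNorm A _

namespace TraceBounded

variable {X Y : H →L[ℂ] H} {s t : ℝ}

theorem norm_le (h : TraceBounded X t) : ‖X‖ ≤ t := by
  obtain ⟨P, Q, hP, hQ, rfl, ht⟩ := h
  linarith [norm_sub_le P Q, norm_le_re_opTrace hP, norm_le_re_opTrace hQ]

theorem conj (A : H →L[ℂ] H) (hX : TraceBounded X t) :
    TraceBounded (A * X * star A) (‖A‖ ^ 2 * t) := by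
  obtain ⟨P, Q, hP, hQ, rfl, ht⟩ := hX
  refine ⟨_, _, star_right_conjugate_nonneg hP A, star_right_conjugate_nonneg hQ A,
    by noncomm_ring, ?_⟩
  have h := mul_le_mul_of_nonneg_left ht (sq_nonneg ‖A‖)
  linarith [re_opTrace_conj_le hP A, re_opTrace_conj_le hQ A]

/-- Polarization: `2s(AP + PA†) = (A+s)P(A+s)† - (A-s)P(A-s)†`. The two positive terms have total
trace `2 tr(APA†) + 2s² tr P`, and `s = ‖A‖` balances the two contributions. -/
theorem mul_add_mul_star_of_nonneg {P : H →L[ℂ] H} (hP : 0 ≤ P) (A : H →L[ℂ] H) :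
    TraceBounded (A * P + P * star A) (2 * ‖A‖ * (opTrace P).re) := by
  rcases eq_or_ne A 0 with rfl | hA
  · simpa using zero (H := H) le_rfl
  have hs : 0 < ‖A‖ := norm_pos_iff.2 hA
  set s : ℝ := ‖A‖ with hsdef
  have key : A * P + P * star A = ((2 * s)⁻¹ : ℝ) • ((A + (s : ℂ) • 1) * P * star (A + (s : ℂ) • 1))
      - ((2 * s)⁻¹ : ℝ) • ((A - (s : ℂ) • 1) * P * star (A - (s : ℂ) • 1)) := by
    rw [← smul_sub]
    have : (A + (s : ℂ) • 1) * P * star (A + (s : ℂ) • 1)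
        - (A - (s : ℂ) • 1) * P * star (A - (s : ℂ) • 1)
        = ((2 * s : ℝ) : ℂ) • (A * P + P * star A) := by
      simp only [star_add, star_sub, star_smul, star_one, mul_add, add_mul, mul_sub, sub_mul,
        smul_mul_assoc, mul_smul_comm, one_mul, mul_one, RCLike.star_def, Complex.conj_ofReal]
      push_cast
      module
    rw [this, Complex.coe_smul, smul_smul, inv_mul_cancel₀ (by positivity), one_smul]
  have h2 : (0 : ℝ) ≤ (2 * s)⁻¹ := by positivity
  refine ⟨_, _, smul_nonneg h2 (star_right_conjugate_nonneg hP _),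
    smul_nonneg h2 (star_right_conjugate_nonneg hP _), key, ?_⟩
  rw [← Complex.coe_smul, ← Complex.coe_smul]
  simp only [map_smul, smul_eq_mul, Complex.re_ofReal_mul, ← mul_add]
  have hsum : (A + (s : ℂ) • 1) * P * star (A + (s : ℂ) • 1)
      + (A - (s : ℂ) • 1) * P * star (A - (s : ℂ) • 1)
      = (2 : ℂ) • (A * P * star A) + ((2 * s ^ 2 : ℝ) : ℂ) • P := by
    simp only [star_add, star_sub, star_smul, star_one, mul_add, add_mul, mul_sub, sub_mul,
      smul_mul_assoc, mul_smul_comm, one_mul, mul_one, RCLike.star_def, Complex.conj_ofReal]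
    push_cast
    module
  rw [← Complex.add_re, ← map_add, hsum, map_add, map_smul, map_smul, smul_eq_mul, smul_eq_mul,
    Complex.add_re, Complex.re_ofReal_mul]
  have h3 := re_opTrace_conj_le hP A
  have h4 : ((2 : ℂ) * opTrace (A * P * star A)).re = 2 * (opTrace (A * P * star A)).re := by simp
  rw [h4, inv_mul_le_iff₀ (by positivity)]
  nlinarith

theorem mul_add_mul_star (A : H →L[ℂ] H) (hX : TraceBounded X t) :
    TraceBounded (A * X + X * star A) (2 * ‖A‖ * t) := by
  obtain ⟨P, Q, hP, hQ, rfl, ht⟩ := hX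
  have h := (mul_add_mul_star_of_nonneg hP A).sub (mul_add_mul_star_of_nonneg hQ A)
  have e : A * (P - Q) + (P - Q) * star A
      = A * P + P * star A - (A * Q + Q * star A) := by noncomm_ring
  rw [e]
  refine h.mono ?_
  rw [← mul_add]
  gcongr

theorem dissipator (A : H →L[ℂ] H) (hX : TraceBounded X t) :
    TraceBounded (dissipator A X) (2 * ‖A‖ ^ 2 * t) := by
  have h := (hX.conj A).sub ((hX.mul_add_mul_star (star A * A)).smul (c := 1 / 2) (by norm_num))
  rw [dissipator_apply]
  simp only [star_mul, star_star, CStarRing.norm_star_mul_self] at h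
  push_cast at h
  refine h.mono (le_of_eq ?_)
  ring

end TraceBounded

end Trace

/-! ### Exponentials of bounded operators acting on a vector. -/

section Exponential

variable {E : Type*} [NormedAddCommGroup E] [NormedSpace ℂ E] [CompleteSpace E]

theorem hasSum_exp_apply (A : E →L[ℂ] E) (x : E) :
    HasSum (fun n : ℕ => (n.factorial : ℂ)⁻¹ • (A ^ n) x) (NormedSpace.exp A x) :=
  (NormedSpace.exp_series_hasSum_exp' (𝕂 := ℂ) A).mapL (ContinuousLinearMap.apply ℂ E x)

theorem exp_smul_one_add_apply (c : ℂ) (A : E →L[ℂ] E) (x : E) :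
    NormedSpace.exp (c • 1 + A) x = Complex.exp c • NormedSpace.exp A x := by
  let +nondep : NormedAlgebra ℚ (E →L[ℂ] E) := .restrictScalars ℚ ℂ _
  have hc : Commute (c • (1 : E →L[ℂ] E)) A := (Commute.one_left A).smul_left _
  rw [NormedSpace.exp_add_of_commute hc, ← Algebra.algebraMap_eq_smul_one,
    ← NormedSpace.algebraMap_exp_comm, Algebra.algebraMap_eq_smul_one, smul_one_mul,
    _root_.smul_apply, ← Complex.exp_eq_exp_ℂ]

theorem tendsto_exp_add_smul_apply (A B : E →L[ℂ] E) (x : E) :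
    Tendsto (fun h : ℝ => NormedSpace.exp (A + (h : ℂ) • B) x) (𝓝[>] 0)
      (𝓝 (NormedSpace.exp A x)) := by
  let +nondep : NormedAlgebra ℚ (E →L[ℂ] E) := .restrictScalars ℚ ℂ _
  have h1 : Continuous fun h : ℝ => A + (h : ℂ) • B := by fun_prop
  have h2 : Continuous fun h : ℝ => NormedSpace.exp (A + (h : ℂ) • B) x :=
    (ContinuousLinearMap.apply ℂ E x).continuous.comp (NormedSpace.exp_continuous.comp h1)
  have := h2.tendsto 0
  simp only [Complex.ofReal_zero, zero_smul, add_zero] at this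
  exact this.mono_left nhdsWithin_le_nhds

theorem hasDerivAt_exp_smul_apply (A : E →L[ℂ] E) (x : E) (t : ℝ) :
    HasDerivAt (fun t : ℝ => NormedSpace.exp ((t : ℂ) • A) x)
      (NormedSpace.exp ((t : ℂ) • A) (A x)) t := by
  have h1 := (hasDerivAt_exp_smul_const (𝕂 := ℂ) A (t : ℂ))
  have h2 := (ContinuousLinearMap.apply ℂ E x).hasFDerivAt.comp_hasDerivAt (t : ℂ) h1
  have h3 := h2.scomp t Complex.ofRealCLM.hasDerivAt
  simpa [Function.comp_def] using h3

theorem norm_exp_smul_apply_sub_le {A : E →L[ℂ] E} {x : E} {C T : ℝ} (hT : 0 ≤ T)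
    (hC : ∀ t : ℝ, 0 ≤ t → ‖NormedSpace.exp ((t : ℂ) • A) (A x)‖ ≤ C) :
    ‖NormedSpace.exp ((T : ℂ) • A) x - x‖ ≤ C * T := by
  have h := norm_image_sub_le_of_norm_deriv_le_segment' (C := C)
    (fun t _ => (hasDerivAt_exp_smul_apply A x t).hasDerivWithinAt)
    (fun t ht => hC t ht.1) T ⟨hT, le_rfl⟩
  simpa using h

end Exponential

/-! ### Positivity and trace-norm contraction of the semigroup. -/

section Semigroup

variable {H : Type u} [NormedAddCommGroup H] [InnerProductSpace ℂ H] [CompleteSpace H]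

/-- Infinitesimal form of complete positivity: up to a term `G ρ + ρ G†`, the superoperator `L`
maps positive operators to positive operators. -/
def IsPositiveGenerator (L : (H →L[ℂ] H) →L[ℂ] (H →L[ℂ] H)) : Prop :=
  ∃ G : H →L[ℂ] H, ∀ ρ : H →L[ℂ] H, 0 ≤ ρ → 0 ≤ L ρ - (G * ρ + ρ * star G)

namespace IsPositiveGenerator

variable {L K : (H →L[ℂ] H) →L[ℂ] (H →L[ℂ] H)}

theorem zero : IsPositiveGenerator (0 : (H →L[ℂ] H) →L[ℂ] (H →L[ℂ] H)) :=
  ⟨0, fun ρ _ => by simp⟩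

theorem add (hL : IsPositiveGenerator L) (hK : IsPositiveGenerator K) :
    IsPositiveGenerator (L + K) := by
  obtain ⟨G, hG⟩ := hL
  obtain ⟨G', hG'⟩ := hK
  refine ⟨G + G', fun ρ hρ => (add_nonneg (hG ρ hρ) (hG' ρ hρ)).trans_eq ?_⟩
  rw [_root_.add_apply, star_add]
  noncomm_ring

theorem smul {c : ℝ} (hc : 0 ≤ c) (hL : IsPositiveGenerator L) :
    IsPositiveGenerator ((c : ℂ) • L) := by
  obtain ⟨G, hG⟩ := hL
  refine ⟨(c : ℂ) • G, fun ρ hρ => (smul_nonneg hc (hG ρ hρ)).trans_eq ?_⟩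
  rw [_root_.smul_apply, star_smul, RCLike.star_def, Complex.conj_ofReal, smul_mul_assoc,
    mul_smul_comm, ← Complex.coe_smul, smul_sub, smul_add]

theorem sum {ι : Type*} {I : Finset ι} {L : ι → (H →L[ℂ] H) →L[ℂ] (H →L[ℂ] H)}
    (h : ∀ i ∈ I, IsPositiveGenerator (L i)) : IsPositiveGenerator (∑ i ∈ I, L i) := by
  classical
  induction I using Finset.induction_on with
  | empty => simpa using zero
  | insert i I hi ih =>
    rw [Finset.sum_insert hi]
    exact (h i (by simp)).add (ih fun j hj => h j (by simp [hj]))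

theorem dissipator (A : H →L[ℂ] H) : IsPositiveGenerator (dissipator A) := by
  refine ⟨-((1 / 2 : ℂ) • (star A * A)), fun ρ hρ =>
    (star_right_conjugate_nonneg hρ A).trans_eq ?_⟩
  rw [dissipator_apply]
  simp only [← star_eq_adjoint, star_neg, star_smul, star_mul, star_star, smul_mul_assoc,
    mul_smul_comm, neg_mul, mul_neg, smul_add, one_div, star_inv₀, star_ofNat]
  abel

end IsPositiveGenerator

theorem exp_apply_nonneg_of_positive {Φ : (H →L[ℂ] H) →L[ℂ] (H →L[ℂ] H)}
    (hΦ : ∀ ρ, 0 ≤ ρ → 0 ≤ Φ ρ) {ρ : H →L[ℂ] H} (hρ : 0 ≤ ρ) :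
    0 ≤ NormedSpace.exp Φ ρ := by
  refine (hasSum_exp_apply Φ ρ).nonneg fun n => ?_
  have hn : 0 ≤ (Φ ^ n) ρ := by
    induction n with
    | zero => simpa using hρ
    | succ n ih => rw [pow_succ', mul_apply_eq_comp]; exact hΦ _ ih
  have : (n.factorial : ℂ)⁻¹ • (Φ ^ n) ρ = ((n.factorial : ℝ)⁻¹) • (Φ ^ n) ρ := by
    rw [← Complex.coe_smul]
    push_cast
    rfl
  rw [this]
  exact smul_nonneg (by positivity) hn

/-- Completing the square, `h⁻¹(1+hG)ρ(1+hG)† = h⁻¹ρ + Gρ + ρG† + hGρG†`. So adding `hGρG†` and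
`h⁻¹ρ` to `L ρ` gives a positive map, whose exponential series is positive. The multiple of the
identity only contributes a positive scalar factor, and the other perturbation vanishes as `h → 0`.
-/
theorem IsPositiveGenerator.exp_apply_nonneg {L : (H →L[ℂ] H) →L[ℂ] (H →L[ℂ] H)}
    (hL : IsPositiveGenerator L) {ρ : H →L[ℂ] H} (hρ : 0 ≤ ρ) :
    0 ≤ NormedSpace.exp L ρ := by
  obtain ⟨G, hG⟩ := hL
  have hpos : ∀ h : ℝ, 0 < h → 0 ≤ NormedSpace.exp (L + (h : ℂ) • sandwich G (star G)) ρ := by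
    intro h hh
    set Φ : (H →L[ℂ] H) →L[ℂ] (H →L[ℂ] H) :=
      ((h⁻¹ : ℝ) : ℂ) • 1 + (L + (h : ℂ) • sandwich G (star G)) with hΦdef
    have hΦ : ∀ σ, 0 ≤ σ → 0 ≤ Φ σ := by
      intro σ hσ
      have h1 := star_right_conjugate_nonneg hσ (1 + (h : ℂ) • G)
      have h2 := add_nonneg (hG σ hσ) (smul_nonneg (inv_nonneg.2 hh.le) h1)
      refine h2.trans_eq ?_
      have hne : (h : ℂ) ≠ 0 := by exact_mod_cast hh.ne'
      simp only [hΦdef, _root_.add_apply, _root_.smul_apply, sandwich_apply, one_apply_eq_self,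
        ← Complex.coe_smul, star_add, star_one, star_smul, RCLike.star_def, Complex.conj_ofReal,
        mul_add, add_mul, one_mul, mul_one, smul_mul_assoc, mul_smul_comm, smul_add, smul_smul]
      push_cast
      rw [inv_mul_cancel₀ hne, ← mul_assoc, inv_mul_cancel₀ hne]
      module
    have e : NormedSpace.exp (L + (h : ℂ) • sandwich G (star G)) ρ
        = Real.exp (-h⁻¹) • NormedSpace.exp Φ ρ := by
      have e1 : L + (h : ℂ) • sandwich G (star G) = ((-h⁻¹ : ℝ) : ℂ) • 1 + Φ := by
        ext1 σ
        simp only [hΦdef, _root_.add_apply, _root_.smul_apply]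
        push_cast
        module
      rw [e1, exp_smul_one_add_apply, ← Complex.ofReal_exp, Complex.coe_smul]
    rw [e]
    exact smul_nonneg (Real.exp_pos _).le (exp_apply_nonneg_of_positive hΦ hρ)
  exact ge_of_tendsto (tendsto_exp_add_smul_apply L _ ρ)
    (eventually_mem_nhdsWithin.mono fun h hh => hpos h hh)

theorem opTrace_dissipator (A ρ : H →L[ℂ] H) : opTrace (dissipator A ρ) = 0 := by
  rw [dissipator_apply, map_sub, map_smul, map_add, opTrace_mul_comm ρ, opTrace_mul_comm (A * ρ),
    ← mul_assoc, smul_eq_mul]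
  ring

variable [FiniteDimensional ℂ H]

theorem opTrace_exp_apply {L : (H →L[ℂ] H) →L[ℂ] (H →L[ℂ] H)}
    (hL : ∀ ρ, opTrace (L ρ) = 0) (ρ : H →L[ℂ] H) :
    opTrace (NormedSpace.exp L ρ) = opTrace ρ := by
  have h := (hasSum_exp_apply L ρ).mapL (LinearMap.toContinuousLinearMap (opTrace (H := H)))
  have h2 := hasSum_single (f := fun n : ℕ => LinearMap.toContinuousLinearMap (opTrace (H := H))
      ((n.factorial : ℂ)⁻¹ • (L ^ n) ρ)) 0 (by
    intro n hn
    obtain ⟨m, rfl⟩ := Nat.exists_eq_succ_of_ne_zero hn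
    simp [pow_succ', hL])
  simpa using h.unique h2

/-- Both parts of a decomposition into positive operators stay positive and keep their traces. -/
theorem TraceBounded.exp {L : (H →L[ℂ] H) →L[ℂ] (H →L[ℂ] H)} (hL : IsPositiveGenerator L)
    (htr : ∀ ρ, opTrace (L ρ) = 0) {X : H →L[ℂ] H} {t : ℝ} (hX : TraceBounded X t) :
    TraceBounded (NormedSpace.exp L X) t := by
  obtain ⟨P, Q, hP, hQ, rfl, ht⟩ := hX
  refine ⟨_, _, hL.exp_apply_nonneg hP, hL.exp_apply_nonneg hQ, map_sub _ _ _, ?_⟩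
  rwa [opTrace_exp_apply htr, opTrace_exp_apply htr]

/-- If `ρ + Z` is nearly stationary for the semigroup generated by `L` and `Z` is small, then the
orbit of `ρ` stays close to `ρ`. -/
theorem evolutionError_le {L : (H →L[ℂ] H) →L[ℂ] (H →L[ℂ] H)} (hL : IsPositiveGenerator L)
    (htr : ∀ ρ, opTrace (L ρ) = 0) {ρ Z : H →L[ℂ] H} {s t : ℝ} (hZ : TraceBounded Z s)
    (hLZ : TraceBounded (L (ρ + Z)) t) {T : ℝ} (hT : 0 ≤ T) :
    evolutionError L T ρ ≤ 2 * s + t * T := by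
  have htr' : ∀ c : ℝ, ∀ σ, opTrace (((c : ℂ) • L) σ) = 0 := fun c σ => by
    rw [_root_.smul_apply, map_smul, htr, smul_zero]
  have h := norm_exp_smul_apply_sub_le hT fun x hx =>
    (hLZ.exp (hL.smul hx) (htr' x)).norm_le
  have h2 := (hZ.exp (hL.smul hT) (htr' T)).norm_le
  have e : NormedSpace.exp ((T : ℂ) • L) ρ - ρ
      = (NormedSpace.exp ((T : ℂ) • L) (ρ + Z) - (ρ + Z))
        - NormedSpace.exp ((T : ℂ) • L) Z + Z := by
    rw [map_add]; abel
  rw [evolutionError, e]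
  refine (norm_add_le _ _).trans ?_
  linarith [norm_sub_le (NormedSpace.exp ((T : ℂ) • L) (ρ + Z) - (ρ + Z))
    (NormedSpace.exp ((T : ℂ) • L) Z), hZ.norm_le]

end Semigroup

/-! ### First-order cancellation of the intrinsic dissipation. -/

section Perturbation

variable {H : Type u} [NormedAddCommGroup H] [InnerProductSpace ℂ H] [CompleteSpace H]
  {ι : Type*} [Fintype ι] {J : ι → (H →L[ℂ] H)} {Q F ρ : H →L[ℂ] H} {a : ℂ} {g : ι → ℂ}

/-- The coherence between code space and complement created by the jump operator `F`, where `Q`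
is the projection onto the complement of the code space. -/
noncomputable def coherenceOp (Q F : H →L[ℂ] H) : H →L[ℂ] H :=
  Q * F * (1 - Q) * star F - (1 / 2 : ℂ) • (Q * star F * F)

/-- The solution `X` of `∑ j, D(J j) X = - D(F) ρ` for a code state `ρ`. -/
noncomputable def corrector (Q F ρ : H →L[ℂ] H) : H →L[ℂ] H :=
  Q * F * ρ * star (Q * F)
    + ((2 : ℝ) : ℂ) • (coherenceOp Q F * ρ + ρ * star (coherenceOp Q F))

theorem sum_dissipator_apply_eq (hJ : ∑ j, star (J j) * J j = Q) (X : H →L[ℂ] H) :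
    ∑ j, dissipator (J j) X
      = ∑ j, J j * X * star (J j) - (1 / 2 : ℂ) • (Q * X + X * Q) := by
  simp only [dissipator_apply, ← star_eq_adjoint, Finset.sum_sub_distrib, ← Finset.smul_sum,
    Finset.sum_add_distrib, ← Finset.sum_mul, ← Finset.mul_sum, hJ]

theorem sum_dissipator_code_state (hJ : ∑ j, star (J j) * J j = Q) (hJρ : ∀ j, J j * ρ = 0)
    (hQρ : Q * ρ = 0) (hρQ : ρ * Q = 0) : ∑ j, dissipator (J j) ρ = 0 := by
  rw [sum_dissipator_apply_eq hJ]
  simp [hJρ, hQρ, hρQ]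

/-- The jump terms vanish because `J j` kills the code factor of each summand, and `Q` acts on only
one side of a coherence. The resulting rate 1/2 is why `corrector` carries the factor 2. -/
theorem sum_dissipator_coherence (hJ : ∑ j, star (J j) * J j = Q) (hJρ : ∀ j, J j * ρ = 0)
    (hρ : star ρ = ρ) (hQ : star Q = Q) (hQρ : Q * ρ = 0) {B : H →L[ℂ] H} (hB : Q * B = B) :
    ∑ j, dissipator (J j) (B * ρ + ρ * star B) = -(1 / 2 : ℂ) • (B * ρ + ρ * star B) := by
  have hρQ : ρ * Q = 0 := by simpa [hρ, hQ] using congrArg star hQρ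
  have hρJ : ∀ j, ρ * star (J j) = 0 := fun j => by simpa [hρ] using congrArg star (hJρ j)
  have hB' : star B * Q = star B := by simpa [hQ] using congrArg star hB
  have h1 : ∀ j, J j * (B * ρ + ρ * star B) * star (J j) = 0 := fun j => by
    rw [mul_add, add_mul, ← mul_assoc, mul_assoc _ ρ, hρJ, ← mul_assoc (J j), hJρ]
    simp
  have h2 : Q * (B * ρ + ρ * star B) + (B * ρ + ρ * star B) * Q = B * ρ + ρ * star B := by
    rw [mul_add, add_mul, ← mul_assoc, hB, ← mul_assoc Q, hQρ, mul_assoc B, hρQ, mul_assoc ρ, hB']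
    simp
  rw [sum_dissipator_apply_eq hJ, Finset.sum_eq_zero fun j _ => h1 j, h2, zero_sub, neg_smul]

/-- Populations have `Q` on both sides, so they decay at rate 1, and the jumps return them to `ρ`
undistorted. -/
theorem sum_dissipator_jump (hJ : ∑ j, star (J j) * J j = Q) (hρ : star ρ = ρ)
    (hQ : star Q = Q) (hQQ : Q * Q = Q) (hJQ : ∀ j, J j * Q = J j)
    (hJF : ∀ j, J j * F * ρ = g j • ρ) :
    ∑ j, dissipator (J j) (Q * F * ρ * star (Q * F))
      = (∑ j, star (g j) * g j) • ρ - Q * F * ρ * star (Q * F) := by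
  have hρJ : ∀ j, ρ * star (J j * F) = star (g j) • ρ := fun j => by
    have := congrArg star (hJF j)
    rwa [star_mul, star_smul, hρ] at this
  have h1 : ∀ j, J j * (Q * F * ρ * star (Q * F)) * star (J j) = (star (g j) * g j) • ρ := by
    intro j
    calc J j * (Q * F * ρ * star (Q * F)) * star (J j)
        = (J j * Q) * F * ρ * star ((J j * Q) * F) := by simp only [star_mul, mul_assoc]
      _ = _ := by rw [hJQ, hJF, smul_mul_assoc, hρJ, smul_smul, mul_comm]
  have h2 : Q * (Q * F * ρ * star (Q * F)) + Q * F * ρ * star (Q * F) * Q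
      = (2 : ℂ) • (Q * F * ρ * star (Q * F)) := by
    have e1 : Q * (Q * F * ρ * star (Q * F)) = Q * F * ρ * star (Q * F) := by
      simp only [← mul_assoc, hQQ]
    have e2 : Q * F * ρ * star (Q * F) * Q = Q * F * ρ * star (Q * F) := by
      rw [mul_assoc, star_mul, hQ, mul_assoc (star F), hQQ]
    rw [e1, e2, two_smul]
  rw [sum_dissipator_apply_eq hJ, Finset.sum_congr rfl fun j _ => h1 j, h2, ← Finset.sum_smul,
    smul_smul]
  norm_num

/-- Block decomposition with respect to `1 - Q` and `Q`. The `|a|²` terms of gain and loss cancel,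
leaving in the code block exactly the loss that `sum_dissipator_jump` replenishes. -/
theorem dissipator_code_state (hJ : ∑ j, star (J j) * J j = Q) (hρ : star ρ = ρ)
    (hQ : star Q = Q) (hQQ : Q * Q = Q) (hQρ : Q * ρ = 0)
    (ha : (1 - Q) * F * (1 - Q) = a • (1 - Q)) (hJF : ∀ j, J j * F * (1 - Q) = g j • (1 - Q)) :
    dissipator F ρ = Q * F * ρ * star (Q * F)
      + (coherenceOp Q F * ρ + ρ * star (coherenceOp Q F)) - (∑ j, star (g j) * g j) • ρ := by
  have hPρ : (1 - Q) * ρ = ρ := by rw [sub_mul, one_mul, hQρ, sub_zero]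
  have hP : star (1 - Q) = 1 - Q := by rw [star_sub, star_one, hQ]
  have hFρ : F * ρ = a • ρ + Q * F * ρ := by
    have h := congrArg (· * ρ) ha
    simp only [mul_assoc, hPρ, smul_mul_assoc] at h
    rw [sub_mul, one_mul] at h
    rw [mul_assoc, ← h]
    abel
  have ha' : (1 - Q) * star F * (1 - Q) = star a • (1 - Q) := by
    have h := congrArg star ha
    rwa [star_mul, star_mul, star_smul, hP, ← mul_assoc] at h
  have hFρ' : (1 - Q) * star F * ρ = star a • ρ := by
    have h := congrArg (· * ρ) ha'
    simpa only [mul_assoc, hPρ, smul_mul_assoc] using h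
  have hJF' : ∀ j, (1 - Q) * star F * star (J j) = star (g j) • (1 - Q) := fun j => by
    have h := congrArg star (hJF j)
    rwa [star_mul, star_mul, star_smul, hP, ← mul_assoc] at h
  have hPP : (1 - Q) * (1 - Q) = 1 - Q := by
    rw [mul_sub, mul_one, sub_mul, one_mul, hQQ, sub_self, sub_zero]
  -- Inserting `1 = (1 - Q) + ∑ j, J j† J j` between `F†` and `F` reduces this block to the scalars
  -- `a` and `g j`.
  have hFF : (1 - Q) * star F * F * (1 - Q)
      = (star a * a + ∑ j, star (g j) * g j) • (1 - Q) := by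
    have h1 : (1 - Q) + ∑ j, star (J j) * J j = 1 := by rw [hJ]; abel
    calc (1 - Q) * star F * F * (1 - Q)
        = (1 - Q) * star F * ((1 - Q) * (1 - Q) + ∑ j, star (J j) * J j) * F * (1 - Q) := by
          rw [hPP, h1, mul_one]
      _ = ((1 - Q) * star F * (1 - Q)) * ((1 - Q) * F * (1 - Q))
          + ∑ j, ((1 - Q) * star F * star (J j)) * (J j * F * (1 - Q)) := by
          simp only [mul_add, add_mul, Finset.mul_sum, Finset.sum_mul, mul_assoc]
      _ = _ := by
          simp only [ha, ha', hJF, hJF', smul_mul_assoc, mul_smul_comm, hPP, smul_smul,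
            add_smul, Finset.sum_smul, mul_comm]
  have hFFρ : star F * F * ρ
      = (star a * a + ∑ j, star (g j) * g j) • ρ + Q * star F * F * ρ := by
    have h := congrArg (· * ρ) hFF
    simp only [mul_assoc, hPρ, smul_mul_assoc] at h
    rw [sub_mul, one_mul] at h
    simp only [mul_assoc]
    rw [← h]
    abel
  have hBρ : coherenceOp Q F * ρ
      = star a • (Q * F * ρ) - (1 / 2 : ℂ) • (Q * star F * F * ρ) := by
    rw [coherenceOp, sub_mul, smul_mul_assoc, mul_assoc (Q * F), mul_assoc (Q * F), hFρ',
      mul_smul_comm]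
  have hρF : ρ * star F = star a • ρ + ρ * star (Q * F) := by
    simpa [star_mul, star_add, star_smul, hρ, mul_assoc] using congrArg star hFρ
  have hρFF : ρ * (star F * F)
      = (star a * a + ∑ j, star (g j) * g j) • ρ + ρ * star F * F * Q := by
    have h := congrArg star hFFρ
    simpa [hρ, hQ, mul_assoc, mul_comm] using h
  have hρB : ρ * star (coherenceOp Q F)
      = a • (ρ * star (Q * F)) - (1 / 2 : ℂ) • (ρ * star F * F * Q) := by
    have h := congrArg star hBρ
    simpa [hρ, hQ, mul_assoc] using h
  have hFρF : F * ρ * star F = (star a * a) • ρ + a • (ρ * star (Q * F))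
      + star a • (Q * F * ρ) + Q * F * ρ * star (Q * F) := by
    rw [hFρ, add_mul, smul_mul_assoc, hρF, mul_assoc (Q * F) ρ, hρF, mul_add, mul_smul_comm,
      smul_add, smul_smul, mul_comm a, ← mul_assoc]
    abel
  rw [dissipator_apply, ← star_eq_adjoint, hFρF, hFFρ, hρFF, hBρ, hρB]
  module

/-- The corrector compensates the intrinsic dissipation of a code state to first order. -/
theorem dissipator_add_sum_dissipator_corrector (hJ : ∑ j, star (J j) * J j = Q)
    (hρ : star ρ = ρ) (hQ : star Q = Q) (hQQ : Q * Q = Q) (hQρ : Q * ρ = 0)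
    (hJQ : ∀ j, J j * Q = J j) (ha : (1 - Q) * F * (1 - Q) = a • (1 - Q))
    (hJF : ∀ j, J j * F * (1 - Q) = g j • (1 - Q)) :
    dissipator F ρ + ∑ j, dissipator (J j) (corrector Q F ρ) = 0 := by
  have hPρ : (1 - Q) * ρ = ρ := by rw [sub_mul, one_mul, hQρ, sub_zero]
  have hJρ : ∀ j, J j * ρ = 0 := fun j => by rw [← hJQ, mul_assoc, hQρ, mul_zero]
  have hJFρ : ∀ j, J j * F * ρ = g j • ρ := fun j => by
    have h := congrArg (· * ρ) (hJF j)
    simpa only [mul_assoc, hPρ, smul_mul_assoc] using h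
  have hB : Q * coherenceOp Q F = coherenceOp Q F := by
    simp only [coherenceOp, mul_sub, mul_smul_comm, ← mul_assoc, hQQ]
  simp only [corrector, map_add, map_smul, Finset.sum_add_distrib, ← Finset.smul_sum]
  rw [sum_dissipator_jump hJ hρ hQ hQQ hJQ hJFρ]
  have h := sum_dissipator_coherence hJ hJρ hρ hQ hQρ hB
  simp only [map_add, Finset.sum_add_distrib] at h
  rw [h, dissipator_code_state hJ hρ hQ hQQ hQρ ha hJF]
  push_cast
  module

theorem norm_le_one_of_projection (hQ : star Q = Q) (hQQ : Q * Q = Q) : ‖Q‖ ≤ 1 :=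
  IsStarProjection.norm_le Q ⟨hQQ, hQ⟩

theorem norm_coherenceOp_le (hQ : star Q = Q) (hQQ : Q * Q = Q) :
    ‖coherenceOp Q F‖ ≤ 3 / 2 * ‖F‖ ^ 2 := by
  have hQ1 := norm_le_one_of_projection hQ hQQ
  have hP1 : ‖1 - Q‖ ≤ 1 := norm_le_one_of_projection (by rw [star_sub, star_one, hQ])
    (by rw [mul_sub, mul_one, sub_mul, one_mul, hQQ, sub_self, sub_zero])
  have h1 : ‖Q * F * (1 - Q) * star F‖ ≤ ‖F‖ ^ 2 :=
    calc _ ≤ ‖Q‖ * ‖F‖ * ‖1 - Q‖ * ‖star F‖ := by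
          refine (norm_mul_le _ _).trans ?_
          gcongr
          refine (norm_mul_le _ _).trans ?_
          gcongr
          exact norm_mul_le _ _
      _ ≤ 1 * ‖F‖ * 1 * ‖F‖ := by rw [norm_star]; gcongr
      _ = _ := by ring
  have h2 : ‖Q * star F * F‖ ≤ ‖F‖ ^ 2 :=
    calc _ ≤ ‖Q‖ * ‖star F‖ * ‖F‖ := by
          refine (norm_mul_le _ _).trans ?_
          gcongr
          exact norm_mul_le _ _
      _ ≤ 1 * ‖F‖ * ‖F‖ := by rw [norm_star]; gcongr
      _ = _ := by ring
  refine (norm_sub_le _ _).trans ?_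
  rw [norm_smul]
  norm_num
  linarith

variable [FiniteDimensional ℂ H]

theorem traceBounded_corrector (hQ : star Q = Q) (hQQ : Q * Q = Q) (hρ : 0 ≤ ρ)
    (htr : opTrace ρ = 1) : TraceBounded (corrector Q F ρ) (7 * ‖F‖ ^ 2) := by
  have hρ1 : TraceBounded ρ 1 := .of_nonneg hρ (by simp [htr])
  have h := (hρ1.conj (Q * F)).add
    ((hρ1.mul_add_mul_star (coherenceOp Q F)).smul (c := 2) (by norm_num))
  -- The constant is `7 = 1 + 2 · 2 · (3/2)`: populations, then coherences bounded through
  -- `norm_coherenceOp_le`.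
  refine h.mono ?_
  have h1 : ‖Q * F‖ ≤ ‖F‖ := (norm_mul_le _ _).trans
    (mul_le_of_le_one_left (norm_nonneg _) (norm_le_one_of_projection hQ hQQ))
  have h2 : ‖Q * F‖ ^ 2 ≤ ‖F‖ ^ 2 := by gcongr
  linarith [norm_coherenceOp_le (F := F) hQ hQQ]

/-- If jump operators `J j` with `∑ j, J j† J j = Q` undo the errors `F k` on the range of
`1 - Q`, then pumping them at rate `M` protects the states supported there. -/
theorem evolutionError_lindbladian_le {κ : Type*} [Fintype κ] {F : κ → (H →L[ℂ] H)}
    {a : κ → ℂ} {g : ι → κ → ℂ} (hJ : ∑ j, star (J j) * J j = Q)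
    (hQ : star Q = Q) (hQQ : Q * Q = Q) (hJQ : ∀ j, J j * Q = J j)
    (ha : ∀ k, (1 - Q) * F k * (1 - Q) = a k • (1 - Q))
    (hJF : ∀ j k, J j * F k * (1 - Q) = g j k • (1 - Q))
    (hρ : 0 ≤ ρ) (htr : opTrace ρ = 1) (hQρ : Q * ρ = 0) (S : H →L[ℂ] H) {M : ℝ} (hM : 0 < M)
    {T : ℝ} (hT : 0 ≤ T) :
    evolutionError (lindbladian (-S) S M J F) T ρ
      ≤ 14 * ((∑ k, ‖F k‖ ^ 2) / M) * (1 + (∑ k, ‖F k‖ ^ 2) * T) := by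
  have hρs : star ρ = ρ := (IsSelfAdjoint.of_nonneg hρ).star_eq
  have hρQ : ρ * Q = 0 := by simpa [hρs, hQ] using congrArg star hQρ
  set γ := ∑ k, ‖F k‖ ^ 2 with hγ
  set L := lindbladian (-S) S M J F with hLdef
  have hLX : ∀ X, L X = (M : ℂ) • ∑ j, dissipator (J j) X + ∑ k, dissipator (F k) X := by
    intro X
    rw [hLdef, lindbladian_apply]
    simp
  have hLpos : IsPositiveGenerator L := by
    have h : L = (M : ℂ) • ∑ j, dissipator (J j) + ∑ k, dissipator (F k) := by
      ext1 X
      rw [hLX]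
      simp only [_root_.add_apply, _root_.smul_apply, _root_.sum_apply]
    rw [h]
    exact .add (.smul hM.le (.sum fun j _ => .dissipator _)) (.sum fun k _ => .dissipator _)
  have hLtr : ∀ X, opTrace (L X) = 0 := by
    intro X
    rw [hLX]
    simp [opTrace_dissipator]
  set Y := ∑ k, corrector Q (F k) ρ with hYdef
  have hY : TraceBounded Y (7 * γ) := by
    rw [hγ, Finset.mul_sum]
    exact .sum fun k _ => traceBounded_corrector hQ hQQ hρ htr
  set Z := ((M⁻¹ : ℝ) : ℂ) • Y with hZdef
  have hZ : TraceBounded Z (M⁻¹ * (7 * γ)) := hY.smul (by positivity)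
  have hJY : ∑ j, dissipator (J j) Y = -∑ k, dissipator (F k) ρ := by
    simp only [hYdef, map_sum]
    rw [Finset.sum_comm, ← Finset.sum_neg_distrib]
    refine Finset.sum_congr rfl fun k _ => eq_neg_of_add_eq_zero_right ?_
    exact dissipator_add_sum_dissipator_corrector hJ hρs hQ hQQ hQρ hJQ (ha k)
      fun j => hJF j k
  have hLZ : L (ρ + Z) = ∑ k, dissipator (F k) Z := by
    have hM' : (M : ℂ) ≠ 0 := by exact_mod_cast hM.ne'
    have h1 : ∑ j, dissipator (J j) ρ = 0 :=
      sum_dissipator_code_state hJ (fun j => by rw [← hJQ, mul_assoc, hQρ, mul_zero]) hQρ hρQ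
    have h2 : (M : ℂ) • ∑ j, dissipator (J j) Z = -∑ k, dissipator (F k) ρ := by
      simp only [hZdef, map_smul]
      rw [← Finset.smul_sum, hJY, smul_smul, Complex.ofReal_inv, mul_inv_cancel₀ hM', one_smul]
    rw [hLX]
    simp only [map_add, Finset.sum_add_distrib]
    rw [h1, zero_add, h2]
    abel
  have hLZ' : TraceBounded (L (ρ + Z)) (∑ k, 2 * ‖F k‖ ^ 2 * (M⁻¹ * (7 * γ))) := by
    rw [hLZ]
    exact .sum fun k _ => hZ.dissipator _
  -- Here `s = 7γ/M` and `t = 2γ · 7γ/M`, so `2s + tT = 14(γ/M)(1 + γT)`.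
  refine (evolutionError_le hLpos hLtr hZ hLZ' hT).trans (le_of_eq ?_)
  rw [← Finset.sum_mul, ← Finset.mul_sum, ← hγ]
  field_simp
  ring

end Perturbation

/-! ### Consequences of the Knill–Laflamme condition. -/

section Code

variable {H : Type u} [NormedAddCommGroup H] [InnerProductSpace ℂ H] {d N : ℕ} {W : Fin d → H}
  {F : Fin N → (H →L[ℂ] H)}

theorem codeProj_apply (W : Fin d → H) (x : H) : codeProj W x = ∑ μ, ⟪W μ, x⟫_ℂ • W μ := by
  simp only [codeProj, _root_.sum_apply, ketBra_apply]

theorem codeProj_apply_word (hW : Orthonormal ℂ W) (μ : Fin d) : codeProj W (W μ) = W μ := by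
  rw [codeProj_apply]
  simp [orthonormal_iff_ite.1 hW]

theorem inner_word_codeProj (hW : Orthonormal ℂ W) (μ : Fin d) (x : H) :
    ⟪W μ, codeProj W x⟫_ℂ = ⟪W μ, x⟫_ℂ := by
  rw [codeProj_apply]
  simp [orthonormal_iff_ite.1 hW]

theorem codeProj_of_mem (hW : Orthonormal ℂ W) {x : H} (hx : x ∈ codeSpace W) :
    codeProj W x = x := by
  have h : codeSpace W ≤ LinearMap.eqLocus (codeProj W : H →ₗ[ℂ] H) LinearMap.id :=
    Submodule.span_le.2 (by rintro _ ⟨μ, rfl⟩; exact codeProj_apply_word hW μ)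
  exact h hx

theorem codeProj_mul_self (hW : Orthonormal ℂ W) : codeProj W * codeProj W = codeProj W := by
  ext x
  rw [mul_apply_eq_comp, codeProj_apply W x, map_sum]
  simp only [map_smul, codeProj_apply_word hW]

theorem mul_codeProj_eq {A B : H →L[ℂ] H} (h : ∀ μ, A (W μ) = B (W μ)) :
    A * codeProj W = B * codeProj W := by
  ext x
  simp only [mul_apply_eq_comp, codeProj_apply, map_sum, map_smul, h]

theorem mul_codeProj_eq_smul {A : H →L[ℂ] H} {c : ℂ} (h : ∀ μ, A (W μ) = c • W μ) :
    A * codeProj W = c • codeProj W := by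
  rw [mul_codeProj_eq (B := c • 1) (by simpa using h), smul_one_mul]

theorem corruptedSector_eq_span (W : Fin d → H) (F : Fin N → (H →L[ℂ] H)) (μ : Fin d) :
    corruptedSector W F μ = Submodule.span ℂ (Set.range fun l => errorSet F l (W μ)) := by
  have h : (fun l => errorSet F l (W μ)) = Fin.cons (W μ) fun k => F k (W μ) := by
    funext l
    refine Fin.cases ?_ (fun k => ?_) l
    · simp [errorSet]
    · simp [errorSet]
  rw [corruptedSector, h, Fin.range_cons, Set.singleton_union]

theorem word_mem_corruptedSector (W : Fin d → H) (F : Fin N → (H →L[ℂ] H)) (μ : Fin d) :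
    W μ ∈ corruptedSector W F μ :=
  Submodule.subset_span (Or.inl rfl)

theorem error_word_mem_corruptedSector (W : Fin d → H) (F : Fin N → (H →L[ℂ] H)) (μ : Fin d)
    (k : Fin N) : F k (W μ) ∈ corruptedSector W F μ :=
  Submodule.subset_span (Or.inr ⟨k, rfl⟩)

theorem corruptedSector_le (W : Fin d → H) (F : Fin N → (H →L[ℂ] H)) (μ : Fin d) :
    corruptedSector W F μ ≤ corruptedCodeSpace W F :=
  le_iSup (corruptedSector W F) μ

variable [CompleteSpace H]

theorem star_ketBra (a b : H) : star (ketBra a b) = ketBra b a := by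
  rw [star_eq_adjoint, eq_comm, eq_adjoint_iff]
  intro x y
  rw [ketBra_apply, ketBra_apply, inner_smul_left, inner_smul_right, inner_conj_symm, mul_comm]

theorem star_codeProj (W : Fin d → H) : star (codeProj W) = codeProj W := by
  simp only [codeProj, star_sum, star_ketBra]

/-- Matrix elements of the condition between code words. The single constant `c l' l` gives both
orthogonality of distinct sectors and equal Gram matrices within them. -/
theorem KnillLaflamme.exists_inner (hW : Orthonormal ℂ W) (hKL : KnillLaflamme W F) :
    ∃ c : Fin (N + 1) → Fin (N + 1) → ℂ, ∀ l' l μ ν,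
      ⟪errorSet F l' (W μ), errorSet F l (W ν)⟫_ℂ = if μ = ν then c l' l else 0 := by
  obtain ⟨c, hc⟩ := hKL
  refine ⟨c, fun l' l μ ν => ?_⟩
  have h := congrArg (fun A : H →L[ℂ] H => ⟪W μ, A (W ν)⟫_ℂ) (hc l' l)
  simp only [mul_apply_eq_comp, _root_.smul_apply, codeProj_apply_word hW,
    inner_word_codeProj hW, adjoint_inner_right, inner_smul_right,
    orthonormal_iff_ite.1 hW] at h
  simpa using h

theorem KnillLaflamme.corruptedSector_isOrtho (hW : Orthonormal ℂ W) (hKL : KnillLaflamme W F)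
    {μ ν : Fin d} (h : μ ≠ ν) : corruptedSector W F μ ⟂ corruptedSector W F ν := by
  obtain ⟨c, hc⟩ := hKL.exists_inner hW
  rw [corruptedSector_eq_span, corruptedSector_eq_span, Submodule.isOrtho_span]
  rintro _ ⟨l, rfl⟩ _ ⟨l', rfl⟩
  rw [hc, if_neg h]

theorem KnillLaflamme.exists_codeProj_error (hW : Orthonormal ℂ W) (hKL : KnillLaflamme W F) :
    ∃ a : Fin N → ℂ, ∀ k, codeProj W * F k * codeProj W = a k • codeProj W := by
  obtain ⟨c, hc⟩ := hKL.exists_inner hW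
  refine ⟨fun k => c 0 k.succ, fun k => mul_codeProj_eq_smul fun μ => ?_⟩
  have h : ∀ ν, ⟪W ν, F k (W μ)⟫_ℂ = if ν = μ then c 0 k.succ else 0 := fun ν => by
    simpa [errorSet] using hc 0 k.succ ν μ
  rw [mul_apply_eq_comp, codeProj_apply]
  simp [h]

end Code

/-! ### Existence of a design. -/

section Existence

variable {H : Type u} [NormedAddCommGroup H] [InnerProductSpace ℂ H]
  {d N : ℕ} {W : Fin d → H} {F : Fin N → (H →L[ℂ] H)}

/-- The operator combination `∑ l, α l • E l` applied to the code word `W μ`. -/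
noncomputable def errorComb (W : Fin d → H) (F : Fin N → (H →L[ℂ] H)) (μ : Fin d) :
    (Fin (N + 1) → ℂ) →ₗ[ℂ] H :=
  Fintype.linearCombination ℂ fun l => errorSet F l (W μ)

theorem errorComb_apply (μ : Fin d) (α : Fin (N + 1) → ℂ) :
    errorComb W F μ α = ∑ l, α l • errorSet F l (W μ) := rfl

theorem range_errorComb (μ : Fin d) :
    LinearMap.range (errorComb W F μ) = corruptedSector W F μ := by
  rw [corruptedSector_eq_span]
  exact Fintype.range_linearCombination ℂ _

theorem exists_orthonormal_cons_span_eq [FiniteDimensional ℂ H] {w : H} (hw : ‖w‖ = 1)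
    {S : Submodule ℂ H} (hwS : w ∈ S) :
    ∃ (r : ℕ) (v : Fin r → H), Orthonormal ℂ (Fin.cons w v : Fin (r + 1) → H) ∧
      Submodule.span ℂ (Set.range (Fin.cons w v : Fin (r + 1) → H)) = S := by
  set K : Submodule ℂ H := (Submodule.span ℂ {w})ᗮ ⊓ S with hK
  set b := stdOrthonormalBasis ℂ K
  have hwv : ∀ i, ⟪w, (b i : H)⟫_ℂ = 0 := fun i =>
    Submodule.mem_orthogonal_singleton_iff_inner_right.1 (b i).2.1
  refine ⟨_, fun i => (b i : H), ?_, ?_⟩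
  · rw [orthonormal_iff_ite]
    intro i j
    refine Fin.cases ?_ (fun i => ?_) i <;> refine Fin.cases ?_ (fun j => ?_) j
    · simp [inner_self_eq_norm_sq_to_K, hw]
    · simp [hwv, (Fin.succ_ne_zero _).symm]
    · simp [inner_eq_zero_symm.1 (hwv _), Fin.succ_ne_zero]
    · have := orthonormal_iff_ite.1 b.orthonormal i j
      simpa [Submodule.coe_inner] using this
  · have h1 : Submodule.span ℂ (Set.range fun i => (b i : H)) = K := by
      have h := congrArg (Submodule.map K.subtype) b.toBasis.span_eq
      rw [Submodule.map_span, Submodule.map_top, Submodule.range_subtype, ← Set.range_comp] at h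
      simpa [Function.comp_def] using h
    rw [Fin.range_cons, Submodule.span_insert, h1, hK]
    exact Submodule.sup_orthogonal_inf_of_hasOrthogonalProjection
      ((Submodule.span_singleton_le_iff_mem _ _).2 hwS)

variable [CompleteSpace H]

/-- Equal Gram matrices make all sectors isometric through their error coefficients. This transports
orthonormality, linear relations and matrix elements from one sector to another. -/
theorem KnillLaflamme.inner_errorComb (hW : Orthonormal ℂ W) (hKL : KnillLaflamme W F)
    (μ ν : Fin d) (α β : Fin (N + 1) → ℂ) :
    ⟪errorComb W F μ α, errorComb W F μ β⟫_ℂ = ⟪errorComb W F ν α, errorComb W F ν β⟫_ℂ := by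
  obtain ⟨c, hc⟩ := hKL.exists_inner hW
  simp only [errorComb_apply, sum_inner, inner_sum, inner_smul_left, inner_smul_right, hc,
    if_true]

theorem KnillLaflamme.errorComb_eq_zero (hW : Orthonormal ℂ W) (hKL : KnillLaflamme W F)
    {μ : Fin d} (ν : Fin d) {α : Fin (N + 1) → ℂ} (h : errorComb W F μ α = 0) :
    errorComb W F ν α = 0 := by
  rw [← inner_self_eq_zero (𝕜 := ℂ), hKL.inner_errorComb hW ν μ, h, inner_zero_left]

/-- A design exists: transport an orthonormal basis of one corrupted sector to all the others. -/
theorem KnillLaflamme.nonempty_design [FiniteDimensional ℂ H] (hd : 0 < d) (hW : Orthonormal ℂ W)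
    (hKL : KnillLaflamme W F) : Nonempty (Design W F) := by
  let o : Fin d := ⟨0, hd⟩
  obtain ⟨r, v, hv, hvS⟩ := exists_orthonormal_cons_span_eq (hW.1 o)
    (word_mem_corruptedSector W F o)
  have hmem : ∀ i, ∃ α, errorComb W F o α = (Fin.cons (W o) v : Fin (r + 1) → H) i := fun i => by
    rw [← LinearMap.mem_range, range_errorComb, ← hvS]
    exact Submodule.subset_span ⟨i, rfl⟩
  have hword : ∀ μ, errorComb W F μ (Pi.single 0 1) = W μ := fun μ => by
    simp [errorComb, errorSet]
  have herr : ∀ μ (k : Fin N), errorComb W F μ (Pi.single k.succ 1) = F k (W μ) := fun μ k => by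
    simp [errorComb, errorSet]
  choose α hα using fun i : Fin r => hmem i.succ
  simp only [Fin.cons_succ] at hα
  -- Index 0 of the error set is the identity, so this coefficient vector yields the code word
  -- itself in every sector.
  set α' : Fin (r + 1) → Fin (N + 1) → ℂ := Fin.cons (Pi.single 0 1) α with hα'
  have hV : ∀ μ, (Fin.cons (W μ) fun i => errorComb W F μ (α i) : Fin (r + 1) → H)
      = fun i => errorComb W F μ (α' i) := fun μ => by
    funext i
    refine Fin.cases ?_ (fun i => ?_) i
    · simp [hα', hword]
    · simp [hα']
  have hVo : (fun i => errorComb W F o (α' i)) = (Fin.cons (W o) v : Fin (r + 1) → H) := by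
    rw [← hV]
    simp only [hα]
  refine ⟨{ r := r
            q := Module.finrank ℂ (corruptedCodeSpace W F)ᗮ
            V := fun μ i => errorComb W F μ (α i)
            φ := fun p => (stdOrthonormalBasis ℂ (corruptedCodeSpace W F)ᗮ p : H)
            Φ := fun _ => W o
            orthonormal_sector := fun μ => ?_
            span_sector := fun μ => ?_
            matrixElement_eq := fun μ ν i k => ?_
            orthonormal_residual := ?_
            span_residual := ?_
            target_mem := fun _ => corruptedSector_le W F o (word_mem_corruptedSector W F o)
            norm_target := fun _ => hW.1 o }⟩
  · rw [hV, orthonormal_iff_ite]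
    intro i j
    rw [hKL.inner_errorComb hW μ o]
    rw [← hVo] at hv
    exact orthonormal_iff_ite.1 hv i j
  · rw [hV]
    refine le_antisymm (Submodule.span_le.2 ?_) ?_
    · rintro _ ⟨i, rfl⟩
      rw [← range_errorComb]
      exact LinearMap.mem_range_self _ _
    · rw [← range_errorComb]
      rintro _ ⟨β, rfl⟩
      have hβ : errorComb W F o β ∈ Submodule.span ℂ
          (Set.range fun i => errorComb W F o (α' i)) := by
        rw [hVo, hvS, ← range_errorComb]
        exact LinearMap.mem_range_self _ _
      obtain ⟨c, hc⟩ := (Submodule.mem_span_range_iff_exists_fun ℂ).1 hβ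
      -- The generators may be linearly dependent, so the expansion is transported as a vanishing
      -- combination, which vanishes in every sector.
      have h0 : errorComb W F o (β - ∑ i, c i • α' i) = 0 := by
        rw [map_sub, map_sum, ← hc]
        simp only [map_smul, sub_self]
      have h1 := hKL.errorComb_eq_zero hW μ h0
      rw [map_sub, map_sum, sub_eq_zero] at h1
      rw [h1]
      simp only [map_smul]
      exact (Submodule.mem_span_range_iff_exists_fun ℂ).2 ⟨c, rfl⟩
  · rw [← herr, ← herr, hKL.inner_errorComb hW μ ν]
  · exact (stdOrthonormalBasis ℂ (corruptedCodeSpace W F)ᗮ).orthonormal.comp_linearIsometry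
      (corruptedCodeSpace W F)ᗮ.subtypeₗᵢ
  · have h := congrArg (Submodule.map (corruptedCodeSpace W F)ᗮ.subtype)
      (stdOrthonormalBasis ℂ (corruptedCodeSpace W F)ᗮ).toBasis.span_eq
    rw [Submodule.map_span, Submodule.map_top, Submodule.range_subtype, ← Set.range_comp] at h
    simpa [Function.comp_def] using h

end Existence

/-! ### The engineered jumps of an arbitrary design. -/

namespace Design

variable {H : Type u} [NormedAddCommGroup H] [InnerProductSpace ℂ H]
  {d N : ℕ} {W : Fin d → H} {F : Fin N → (H →L[ℂ] H)} (D : Design W F)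

theorem jump_inl_apply (i : Fin D.r) (x : H) :
    D.jump (Sum.inl i) x = ∑ μ, ⟪D.V μ i, x⟫_ℂ • W μ := by
  simp only [jump, _root_.sum_apply, ketBra_apply]

theorem jump_inr_apply (p : Fin D.q) (x : H) :
    D.jump (Sum.inr p) x = ⟪D.φ p, x⟫_ℂ • D.Φ p := by
  simp only [jump, ketBra_apply]

theorem V_mem (μ : Fin d) (i : Fin D.r) : D.V μ i ∈ corruptedSector W F μ := by
  rw [← D.span_sector μ]
  exact Submodule.subset_span ⟨i.succ, by simp⟩

theorem inner_residual_of_mem (p : Fin D.q) {x : H} (hx : x ∈ corruptedCodeSpace W F) :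
    ⟪D.φ p, x⟫_ℂ = 0 := by
  have h : D.φ p ∈ (corruptedCodeSpace W F)ᗮ := by
    rw [← D.span_residual]
    exact Submodule.subset_span ⟨p, rfl⟩
  exact Submodule.inner_left_of_mem_orthogonal hx h

/-- The vectors of all sector bases together with the residual states. -/
def frame : (Fin d × Fin (D.r + 1)) ⊕ Fin D.q → H
  | Sum.inl x => (Fin.cons (W x.1) (D.V x.1) : Fin (D.r + 1) → H) x.2
  | Sum.inr p => D.φ p

theorem frame_inl_mem (x : Fin d × Fin (D.r + 1)) :
    D.frame (Sum.inl x) ∈ corruptedSector W F x.1 := by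
  rw [← D.span_sector]
  exact Submodule.subset_span ⟨x.2, rfl⟩

theorem top_le_span_frame [FiniteDimensional ℂ H] :
    ⊤ ≤ Submodule.span ℂ (Set.range D.frame) := by
  rw [← Submodule.sup_orthogonal_of_hasOrthogonalProjection (K := corruptedCodeSpace W F)]
  refine sup_le (iSup_le fun μ => ?_) ?_
  · rw [← D.span_sector]
    refine Submodule.span_mono ?_
    rintro _ ⟨i, rfl⟩
    exact ⟨Sum.inl (μ, i), rfl⟩
  · rw [← D.span_residual]
    refine Submodule.span_mono ?_
    rintro _ ⟨p, rfl⟩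
    exact ⟨Sum.inr p, rfl⟩

variable [CompleteSpace H]

theorem orthonormal_frame (hW : Orthonormal ℂ W) (hKL : KnillLaflamme W F) :
    Orthonormal ℂ D.frame := by
  classical
  rw [orthonormal_iff_ite]
  rintro (⟨μ, i⟩ | p) (⟨ν, j⟩ | p')
  · rcases eq_or_ne μ ν with rfl | h
    · simpa [frame] using orthonormal_iff_ite.1 (D.orthonormal_sector μ) i j
    · rw [if_neg (by simp [h])]
      exact (hKL.corruptedSector_isOrtho hW h).inner_eq (D.frame_inl_mem (μ, i))
        (D.frame_inl_mem (ν, j))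
  · rw [if_neg (by simp), inner_eq_zero_symm]
    exact D.inner_residual_of_mem p' (corruptedSector_le W F _ (D.frame_inl_mem (μ, i)))
  · rw [if_neg (by simp)]
    exact D.inner_residual_of_mem p (corruptedSector_le W F _ (D.frame_inl_mem (ν, j)))
  · simpa [frame] using orthonormal_iff_ite.1 D.orthonormal_residual p p'

theorem star_jump_inl_apply (i : Fin D.r) (x : H) :
    star (D.jump (Sum.inl i)) x = ∑ μ, ⟪W μ, x⟫_ℂ • D.V μ i := by
  simp only [jump, star_sum, star_ketBra, _root_.sum_apply, ketBra_apply]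

theorem star_jump_inl_mul_self_apply (hW : Orthonormal ℂ W) (i : Fin D.r) (x : H) :
    (star (D.jump (Sum.inl i)) * D.jump (Sum.inl i)) x = ∑ μ, ⟪D.V μ i, x⟫_ℂ • D.V μ i := by
  rw [mul_apply_eq_comp, jump_inl_apply, star_jump_inl_apply]
  simp [orthonormal_iff_ite.1 hW]

theorem star_jump_inr_mul_self_apply (p : Fin D.q) (x : H) :
    (star (D.jump (Sum.inr p)) * D.jump (Sum.inr p)) x = ⟪D.φ p, x⟫_ℂ • D.φ p := by
  rw [mul_apply_eq_comp, jump_inr_apply, jump, star_ketBra, ketBra_apply, inner_smul_right,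
    inner_self_eq_norm_sq_to_K, D.norm_target]
  simp

/-- Resolution of the identity in `frame`: the jumps account for every basis vector except the code
words. -/
theorem sum_star_jump_mul_self [FiniteDimensional ℂ H] (hW : Orthonormal ℂ W)
    (hKL : KnillLaflamme W F) : ∑ j, star (D.jump j) * D.jump j = 1 - codeProj W := by
  rw [eq_sub_iff_add_eq']
  ext x
  have h := (OrthonormalBasis.mk (D.orthonormal_frame hW hKL) D.top_le_span_frame).sum_repr' x
  simp only [OrthonormalBasis.coe_mk, Fintype.sum_sum_type, Fintype.sum_prod_type, frame,
    Fin.sum_univ_succ, Fin.cons_zero, Fin.cons_succ, Finset.sum_add_distrib] at h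
  rw [_root_.add_apply, _root_.sum_apply, Fintype.sum_sum_type, codeProj_apply,
    one_apply_eq_self]
  simp only [D.star_jump_inl_mul_self_apply hW, D.star_jump_inr_mul_self_apply]
  rw [Finset.sum_comm, ← add_assoc]
  exact h

theorem inner_V_of_ne (hW : Orthonormal ℂ W) (hKL : KnillLaflamme W F) {μ ν : Fin d} (h : ν ≠ μ)
    (i : Fin D.r) {x : H} (hx : x ∈ corruptedSector W F μ) : ⟪D.V ν i, x⟫_ℂ = 0 :=
  (hKL.corruptedSector_isOrtho hW h).inner_eq (D.V_mem ν i) hx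

theorem inner_V_word (hW : Orthonormal ℂ W) (hKL : KnillLaflamme W F) (μ ν : Fin d)
    (i : Fin D.r) : ⟪D.V ν i, W μ⟫_ℂ = 0 := by
  rcases eq_or_ne ν μ with rfl | h
  · simpa using (D.orthonormal_sector ν).2 (Fin.succ_ne_zero i)
  · exact D.inner_V_of_ne hW hKL h i (word_mem_corruptedSector W F μ)

theorem jump_word (hW : Orthonormal ℂ W) (hKL : KnillLaflamme W F) (j : Fin D.r ⊕ Fin D.q)
    (μ : Fin d) : D.jump j (W μ) = 0 := by
  rcases j with i | p
  · simp [jump_inl_apply, D.inner_V_word hW hKL]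
  · rw [jump_inr_apply, D.inner_residual_of_mem p
      (corruptedSector_le W F μ (word_mem_corruptedSector W F μ)), zero_smul]

/-- Orthogonality of sectors leaves one term of a corrective jump, whose coefficient is independent
of `μ` by `matrixElement_eq`; hence no logical information is disturbed. Preventive jumps do not see
first-order errors. -/
theorem exists_jump_error (hd : 0 < d) (hW : Orthonormal ℂ W) (hKL : KnillLaflamme W F) :
    ∃ g : Fin D.r ⊕ Fin D.q → Fin N → ℂ, ∀ j k,
      D.jump j * F k * codeProj W = g j k • codeProj W := by
  refine ⟨fun j k => Sum.elim (fun i => ⟪D.V ⟨0, hd⟩ i, F k (W ⟨0, hd⟩)⟫_ℂ) (fun _ => 0) j,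
    fun j k => mul_codeProj_eq_smul fun μ => ?_⟩
  rw [mul_apply_eq_comp]
  rcases j with i | p
  · rw [jump_inl_apply, Finset.sum_eq_single μ, D.matrixElement_eq μ ⟨0, hd⟩]
    · rfl
    · intro ν _ h
      rw [D.inner_V_of_ne hW hKL h i (error_word_mem_corruptedSector W F μ k), zero_smul]
    · simp
  · rw [jump_inr_apply, D.inner_residual_of_mem p
      (corruptedSector_le W F μ (error_word_mem_corruptedSector W F μ k))]
    simp

/-- The AutoQEC error bound for a given design. -/
theorem evolutionError_le [FiniteDimensional ℂ H] (hd : 0 < d) (hW : Orthonormal ℂ W)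
    (hKL : KnillLaflamme W F) (S : H →L[ℂ] H) {M : ℝ} (hM : 0 < M) {ρ : H →L[ℂ] H}
    (hρ : IsCodeState W ρ) {T : ℝ} (hT : 0 ≤ T) :
    evolutionError (lindbladian (-S) S M D.jump F) T ρ
      ≤ 14 * (intrinsicStrength F / M) * (1 + intrinsicStrength F * T) := by
  obtain ⟨a, ha⟩ := hKL.exists_codeProj_error hW
  obtain ⟨g, hg⟩ := D.exists_jump_error hd hW hKL
  have hP : (1 : H →L[ℂ] H) - (1 - codeProj W) = codeProj W := sub_sub_cancel _ _
  have hJP : ∀ j, D.jump j * codeProj W = 0 := fun j => by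
    rw [mul_codeProj_eq (B := 0) fun μ => D.jump_word hW hKL j μ, zero_mul]
  have hPρ : codeProj W * ρ = ρ := by
    ext x
    exact codeProj_of_mem hW (hρ.range_le ⟨x, rfl⟩)
  refine evolutionError_lindbladian_le (Q := 1 - codeProj W) (a := a) (g := g)
    (D.sum_star_jump_mul_self hW hKL) ?_ ?_ ?_ ?_ ?_ ((nonneg_iff_isPositive ρ).2 hρ.isPositive)
    hρ.trace_eq_one ?_ S hM hT
  · rw [star_sub, star_one, star_codeProj]
  · rw [mul_sub, mul_one, sub_mul, one_mul, codeProj_mul_self hW, sub_self, sub_zero]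
  · intro j
    rw [mul_sub, mul_one, hJP, sub_zero]
  · intro k
    rw [hP, ha]
  · intro j k
    rw [hP, hg]
  · rw [sub_mul, one_mul, hPρ, sub_self]

end Design

end AutoQEC

theorem mainTheorem1 :
    ∃ C : ℝ, 0 < C ∧
      ∀ (H : Type u) [NormedAddCommGroup H] [InnerProductSpace ℂ H] [FiniteDimensional ℂ H]
        [CompleteSpace H] (d N : ℕ) (_ : 0 < d)
        (W : Fin d → H) (_ : Orthonormal ℂ W)
        (F : Fin N → (H →L[ℂ] H)) (_ : AutoQEC.KnillLaflamme W F)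
        (Hsys : H →L[ℂ] H) (_ : IsSelfAdjoint Hsys),
        Nonempty (AutoQEC.Design W F) ∧
        ∀ (D : AutoQEC.Design W F) (M : ℝ) (_ : 0 < M)
          (ρ : H →L[ℂ] H) (_ : AutoQEC.IsCodeState W ρ),
          (∀ T : ℝ, 0 ≤ T →
            AutoQEC.evolutionError (AutoQEC.lindbladian (-Hsys) Hsys M D.jump F) T ρ
              ≤ C * (AutoQEC.intrinsicStrength F / M)
                  * (1 + AutoQEC.intrinsicStrength F * T)) ∧
          (∀ T₀ T : ℝ, 0 < T₀ → T₀ ≤ T →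
            AutoQEC.evolutionError (AutoQEC.lindbladian (-Hsys) Hsys M D.jump F) T ρ
              ≤ C * (1 / T₀ + AutoQEC.intrinsicStrength F)
                  * (AutoQEC.intrinsicStrength F * T / M)) := by
  refine ⟨14, by norm_num, fun H _ _ _ _ d N hd W hW F hKL Hsys _ =>
    ⟨hKL.nonempty_design hd hW, fun D M hM ρ hρ =>
      ⟨fun T hT => D.evolutionError_le hd hW hKL Hsys hM hρ hT, fun T₀ T hT₀ hT => ?_⟩⟩⟩
  refine (D.evolutionError_le hd hW hKL Hsys hM hρ (hT₀.le.trans hT)).trans ?_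
  set γ := AutoQEC.intrinsicStrength F
  have hγ : 0 ≤ γ := Finset.sum_nonneg fun k _ => sq_nonneg ‖F k‖
  -- Away from `T = 0` the constant term, due to the initial transient, is absorbed into the linear
  -- one.
  have h1 : 1 ≤ 1 / T₀ * T := by rwa [one_div, inv_mul_eq_div, one_le_div hT₀]
  calc 14 * (γ / M) * (1 + γ * T) ≤ 14 * (γ / M) * (1 / T₀ * T + γ * T) := by gcongr
    _ = 14 * (1 / T₀ + γ) * (γ * T / M) := by ring
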